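/- Let $(W,S)$ be a Coxeter system of arbitrary (possibly infinite) rank: $W$ is a group generated by $S$ with presentation $\langle S \mid (st)^{m_{s,t}}=1 \text{ whenever } m_{s,t}<\infty\rangle$, where $m_{s,t}=m_{t,s}\in\{1,2,\dots\}\cup\{\infty\}$ and $m_{s,t}=1$ if and only if $s=t$. A group $W$ admitting such an $S$ is called a Coxeter group. The Coxeter graph of $(W,S)$ has vertex set $S$, with $s,t$ joined if and only if $m_{s,t}\ge 3$ (including $m_{s,t}=\infty$). The irreducible components of $(W,S)$ are the subgroups $W_I=\langle I\rangle$, where $I$ is the vertex set of a connected component of the Coxeter graph; $(W,S)$ is irreducible if the graph is connected. Let $W_{\mathrm{fin}}\le W$ be the product of all finite irreducible components of $(W,S)$, i.e. the subgroup they generate. An element $g$ of a group $G$ is almost central if its centralizer has finite index in $G$; an involution is an element of order exactly $2$. Then: 1. The subgroup of $W$ generated by the almost central involutions of $W$ equals $W_{\mathrm{fin}}$. 2. $W_{\mathrm{fin}}$ does not depend on $S$: if $(W,S')$ is another Coxeter system on the same group $W$, then the product of the finite irreducible components of $(W,S')$ is the same subgroup of $W$. 3. If $(W',S')$ is a Coxeter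 system and $f\colon W\to W'$ is an isomorphism of abstract groups, then $f(W_{\mathrm{fin}})=W'_{\mathrm{fin}}$. 4. If $(W,S)$ is irreducible and $W$ is infinite, then $W$ has no almost central involutions. -/

import Mathlib

/-- An element of a group is almost central if its centralizer has finite index. -/
def IsAlmostCentral {G : Type*} [Group G] (g : G) : Prop :=
  (Subgroup.centralizer {g}).FiniteIndex

/-- The set of almost central involutions of a group; an involution is an element of order
exactly two. -/
def almostCentralInvolutions (G : Type*) [Group G] : Set G :=
  {g | orderOf g = 2 ∧ IsAlmostCentral g}

/-- The Coxeter graph: two vertices are joined if and only if the corresponding entry of the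
Coxeter matrix is at least three or infinite (infinity is encoded as `0`). -/
def CoxeterMatrix.coxeterGraph {B : Type*} (M : CoxeterMatrix B) : SimpleGraph B where
  Adj i j := M i j = 0 ∨ 3 ≤ M i j
  symm := ⟨fun i j h => by rwa [M.symmetric j i]⟩
  loopless := ⟨fun i h => by simp at h⟩

namespace CoxeterSystem

/-- The standard parabolic subgroup generated by the simple reflections indexed by `I`. -/
def standardParabolic {B W : Type*} [Group W] {M : CoxeterMatrix B} (cs : CoxeterSystem M W)
    (I : Set B) : Subgroup W :=
  Subgroup.closure (cs.simple '' I)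

/-- The irreducible component of `W` attached to a connected component of the Coxeter graph. -/
def irreducibleComponent {B W : Type*} [Group W] {M : CoxeterMatrix B} (cs : CoxeterSystem M W)
    (c : M.coxeterGraph.ConnectedComponent) : Subgroup W :=
  cs.standardParabolic c.supp

/-- The product in `W` of all finite irreducible components, that is, the subgroup that they
generate. (Different components commute, so its elements are the finite products of elements of
finite irreducible components.) -/
def finitePart {B W : Type*} [Group W] {M : CoxeterMatrix B} (cs : CoxeterSystem M W) :
    Subgroup W :=
  ⨆ (c : M.coxeterGraph.ConnectedComponent) (_ : Finite (cs.irreducibleComponent c)),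
    cs.irreducibleComponent c

end CoxeterSystem

/-!
Almost central means having finitely many conjugates. A Coxeter group `W` acts on the set of signed
reflections, the combinatorial version of its root system: `w` sends `(t, ε)` to
`(w t w⁻¹, ε + N(w, t))`, where the sign cocycle `N` (`inversionSign`) is nonzero exactly at the
inversions `t` of `w`. The theorem follows from two facts about simple reflections.

*The component of an almost central simple reflection `s` is finite*
(`finite_irreducibleComponent_of_isAlmostCentral`). An element fixing the roots of `s` and of
`t s t`, where `t` is a simple reflection not commuting with `s`, commutes with `t`
(`conj_simple_eq_of_conj_eq`). As these two roots have finite orbits, `t` is almost central again,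
and so are all simple reflections of the component. The conjugates of `s` lie in a standard
parabolic subgroup `W_J` with `J` finite; conjugating `s` along a geodesic of the Coxeter graph up
to the last vertex before `v` gives an element that does not commute with `v`, which is impossible
if `v ∉ J` (`commute_simple_of_conj_mem_standardParabolic`). So the component has finite rank, and it acts faithfully on a finite set of signed
reflections.

*An almost central element `g` with `g² = 1` is a product of conjugates of almost central simple
reflections* (`mem_finitePart_of_isAlmostCentral`). Let `s` be a descent of `g`. If `s g s ≠ g`,
then `s g s` is shorter than `g`, and induction applies. If `s g s = g`, then `g` maps the root of
`s` to its negative, so that every conjugate `w s w⁻¹` is among the finitely many inversions of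
`w g w⁻¹`. Since `g` has finitely many conjugates, `s` is almost central, and induction applies to
`g s`.

Hence the almost central involutions generate the finite part, a description that does not mention
the Coxeter generators; the other claims are consequences. The real reflection representation
serves only to show that the simple reflections are distinct, and that those joined in the Coxeter
graph do not commute.
-/

/-! ### The reflection representation -/

namespace CoxeterMatrix

variable {B : Type*} (M : CoxeterMatrix B)

/-- The linear form `2 ⟨αᵢ, ·⟩` on the real vector space with basis the simple roots, where
`⟨αᵢ, αⱼ⟩ = -cos (π / M i j)`. When `M i j = 0`, the encoding of infinity, division by zero makes
this `-cos 0 = -1`, as it should be. -/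
noncomputable def simpleCoroot (i : B) : Module.Dual ℝ (B →₀ ℝ) :=
  Finsupp.linearCombination ℝ fun j => -2 * Real.cos (Real.pi / M i j)

theorem simpleCoroot_single (i j : B) :
    M.simpleCoroot i (Finsupp.single j 1) = -2 * Real.cos (Real.pi / M i j) := by
  simp [simpleCoroot]

theorem simpleCoroot_single_self (i : B) : M.simpleCoroot i (Finsupp.single i 1) = 2 := by
  simp [simpleCoroot_single]

/-- The reflection of the reflection representation attached to a simple root. -/
noncomputable def simpleReflection (i : B) : (B →₀ ℝ) ≃ₗ[ℝ] (B →₀ ℝ) :=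
  Module.reflection (M.simpleCoroot_single_self i)

theorem simpleReflection_single (i j : B) :
    M.simpleReflection i (Finsupp.single j 1) =
      Finsupp.single j 1 + (2 * Real.cos (Real.pi / M i j)) • Finsupp.single i 1 := by
  rw [simpleReflection, Module.reflection_apply, simpleCoroot_single]
  module

open Polynomial.Chebyshev in
/-- Two reflections whose composite rotates by `2π / m` satisfy the braid relation of order `m`. -/
theorem _root_.Module.reflection_mul_reflection_pow_eq_one {V : Type*} [AddCommGroup V]
    [Module ℝ V] {x y : V} {f g : Module.Dual ℝ V} (hf : f x = 2) (hg : g y = 2) {m : ℕ}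
    (hm : 2 ≤ m) (hfy : f y = -2 * Real.cos (Real.pi / m))
    (hgx : g x = -2 * Real.cos (Real.pi / m)) :
    (Module.reflection hf * Module.reflection hg) ^ m = 1 := by
  rcases hm.eq_or_lt with rfl | h3
  · have hc : Real.cos (Real.pi / (2 : ℕ)) = 0 := by simp
    rw [hc, mul_zero] at hfy hgx
    ext1 z
    simp only [pow_two, LinearEquiv.mul_apply, Module.reflection_apply,
      map_sub, map_smul, hf, hg, hfy, hgx, LinearEquiv.coe_one, id_eq]
    module
  · set φ : ℝ := Real.pi / m with hφ
    have hmpos : (0 : ℝ) < m := by positivity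
    have hm3 : (3 : ℝ) ≤ m := by exact_mod_cast h3
    have hmφ : m * φ = Real.pi := by rw [hφ]; field_simp
    have hφpos : 0 < φ := by positivity
    have hsin : Real.sin (2 * φ) ≠ 0 := by
      apply ne_of_gt
      apply Real.sin_pos_of_pos_of_lt_pi (by positivity)
      nlinarith [Real.pi_pos]
    have hS : ∀ k : ℤ, (S ℝ k).eval (2 * Real.cos (2 * φ)) * Real.sin (2 * φ)
        = Real.sin ((k + 1) * (2 * φ)) := fun k => S_two_mul_real_cos (2 * φ) k
    have ht : 2 * Real.cos (2 * φ) = f y * g x - 2 := by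
      rw [hfy, hgx, Real.cos_two_mul]
      ring
    apply LinearEquiv.toLinearMap_injective
    rw [Module.reflection_mul_reflection_pow _ _ m _ ht]
    obtain ⟨n, hn | hn⟩ := Nat.even_or_odd' m
    · -- Both coefficients contain the factor `S (n - 1)`, a multiple of `sin π`.
      have e1 : ((m : ℤ) - 2) / 2 = n - 1 := by lia
      have e2 : ((m : ℤ) - 1) / 2 = n - 1 := by lia
      have h0 : (S ℝ ((n : ℤ) - 1)).eval (2 * Real.cos (2 * φ)) = 0 := by
        have := hS (n - 1)
        have hπ : ((((n : ℤ) - 1 : ℤ) : ℝ) + 1) * (2 * φ) = Real.pi := by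
          rw [← hmφ, hn]; push_cast; ring
        rw [hπ, Real.sin_pi] at this
        exact (mul_eq_zero.mp this).resolve_right hsin
      rw [e1, e2, h0]
      simp only [zero_mul, zero_smul, add_zero]
      rfl
    · -- Both coefficients contain the factor `S n + S (n - 1)`, a multiple of
      -- `sin ((n + 1) 2φ) + sin (n 2φ)`, where the two angles add up to `2π`.
      have e1 : ((m : ℤ) - 2) / 2 = n - 1 := by lia
      have e2 : ((m : ℤ) - 1) / 2 = n := by lia
      have e3 : ((m : ℤ) - 3) / 2 = n - 1 := by lia
      have e4 : (m : ℤ) / 2 = n := by lia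
      have h0 : (S ℝ (n : ℤ)).eval (2 * Real.cos (2 * φ)) +
          (S ℝ ((n : ℤ) - 1)).eval (2 * Real.cos (2 * φ)) = 0 := by
        have h1 := hS n
        have h2 := hS (n - 1)
        have hπ : (((n : ℤ) : ℝ) + 1) * (2 * φ) =
            2 * Real.pi - ((((n : ℤ) - 1 : ℤ) : ℝ) + 1) * (2 * φ) := by
          rw [← hmφ, hn]; push_cast; ring
        rw [hπ, Real.sin_two_pi_sub] at h1
        have h3 : ((S ℝ (n : ℤ)).eval (2 * Real.cos (2 * φ)) +
          (S ℝ ((n : ℤ) - 1)).eval (2 * Real.cos (2 * φ))) * Real.sin (2 * φ) = 0 := by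
          rw [add_mul, h1, h2]; ring
        exact (mul_eq_zero.mp h3).resolve_right hsin
      rw [e1, e2, e3, e4, h0]
      simp only [mul_zero, zero_smul, add_zero]
      rfl

theorem isLiftable_simpleReflection : M.IsLiftable M.simpleReflection := by
  intro i j
  rcases eq_or_ne i j with rfl | hij
  · rw [M.diagonal, pow_one]
    ext1 z
    rw [LinearEquiv.mul_apply, simpleReflection]
    exact Module.involutive_reflection (M.simpleCoroot_single_self i) z
  rcases Nat.eq_zero_or_pos (M i j) with h0 | h0
  · rw [h0, pow_zero]
  have h1 : M i j ≠ 1 := M.off_diagonal i j hij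
  refine Module.reflection_mul_reflection_pow_eq_one _ _ (by lia) (M.simpleCoroot_single i j) ?_
  rw [M.simpleCoroot_single, M.symmetric j i]

end CoxeterMatrix

namespace CoxeterSystem

variable {B W : Type*} [Group W] {M : CoxeterMatrix B} (cs : CoxeterSystem M W)

/-- The reflection representation of a Coxeter group. -/
noncomputable def reflectionRepresentation : W →* ((B →₀ ℝ) ≃ₗ[ℝ] (B →₀ ℝ)) :=
  cs.lift ⟨M.simpleReflection, M.isLiftable_simpleReflection⟩

theorem reflectionRepresentation_simple (i : B) :
    cs.reflectionRepresentation (cs.simple i) = M.simpleReflection i :=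
  cs.lift_apply_simple _ i

theorem simple_injective : Function.Injective cs.simple := by
  classical
  intro i j h
  by_contra hij
  have h1 := congrArg (fun w => cs.reflectionRepresentation w (Finsupp.single i 1) i) h
  have hji : j ≠ i := fun h => hij h.symm
  simp [reflectionRepresentation_simple, M.simpleReflection_single, hji] at h1

theorem simple_ne_one (i : B) : cs.simple i ≠ 1 := fun h => by
  have := cs.length_simple i
  rw [h, cs.length_one] at this
  exact zero_ne_one this

theorem not_commute_simple_of_adj {i j : B} (h : M.coxeterGraph.Adj i j) :
    ¬ Commute (cs.simple i) (cs.simple j) := by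
  intro hc
  have hij : i ≠ j := h.ne
  have hcos : 0 < Real.cos (Real.pi / M i j) := by
    apply Real.cos_pos_of_mem_Ioo
    rcases h with h | h
    · simp [h, Real.pi_pos]
    · have hm : (3 : ℝ) ≤ M i j := by exact_mod_cast h
      have h0 : 0 < Real.pi / M i j := by positivity
      refine ⟨by linarith [Real.pi_pos], ?_⟩
      rw [div_lt_div_iff_of_pos_left Real.pi_pos (by linarith) (by norm_num)]
      linarith
  have h1 := congrArg (fun w => cs.reflectionRepresentation w (Finsupp.single j 1) i) hc.eq
  simp only [map_mul, reflectionRepresentation_simple, LinearEquiv.mul_apply, map_add, map_smul,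
    M.simpleReflection_single, M.symmetric j i] at h1
  simp [hij] at h1
  linarith

theorem commute_simple_of_not_adj {i j : B} (h : ¬ M.coxeterGraph.Adj i j) :
    Commute (cs.simple i) (cs.simple j) := by
  rcases eq_or_ne i j with rfl | hij
  · exact Commute.refl _
  have h1 := M.off_diagonal i j hij
  have h2 : M i j = 2 := by
    simp only [CoxeterMatrix.coxeterGraph, not_or] at h
    lia
  have h3 := cs.simple_mul_simple_pow i j
  rw [h2, pow_two] at h3
  have h4 := eq_inv_of_mul_eq_one_left h3
  rwa [mul_inv_rev, inv_simple, inv_simple] at h4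

end CoxeterSystem

/-! ### The sign cocycle -/

namespace CoxeterSystem

variable {B W : Type*} [Group W] {M : CoxeterMatrix B} (cs : CoxeterSystem M W)

open Classical in
/-- The involution `(t, ε) ↦ (s t s, ε + [t = s])` of `W × ZMod 2`, for a simple reflection `s`.
For a reflection `t`, the pairs `(t, 0)` and `(t, 1)` stand for the positive and the negative root
of `t`, so that this is the action of `s` on the roots. -/
noncomputable def signedConj (i : B) : Equiv.Perm (W × ZMod 2) :=
  Function.Involutive.toPerm
    (fun p => (cs.simple i * p.1 * cs.simple i, p.2 + if p.1 = cs.simple i then 1 else 0)) <| by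
    rintro ⟨t, ε⟩
    have h : cs.simple i * t * cs.simple i = cs.simple i ↔ t = cs.simple i := by
      constructor
      · intro h
        rw [mul_assoc, mul_eq_left] at h
        rw [eq_inv_of_mul_eq_one_left h, inv_simple]
      · rintro rfl
        simp
    simp only [h, add_assoc, CharTwo.add_self_eq_zero, add_zero]
    simp [mul_assoc]

open Classical in
theorem signedConj_apply (i : B) (t : W) (ε : ZMod 2) :
    cs.signedConj i (t, ε) = (cs.simple i * t * cs.simple i,
      ε + if t = cs.simple i then 1 else 0) := rfl

open Classical in
/-- Applying `signedConj i * signedConj j` repeatedly changes the sign of `t` once for each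
occurrence of `t` among the reflections `s j * (s i * s j) ^ n`. -/
theorem signedConj_mul_pow_apply (i j : B) (k : ℕ) (t : W) (ε : ZMod 2) :
    ((cs.signedConj i * cs.signedConj j) ^ k) (t, ε) =
      ((cs.simple i * cs.simple j) ^ k * t * ((cs.simple i * cs.simple j) ^ k)⁻¹,
        ε + ∑ n ∈ Finset.range (2 * k),
          if t = cs.simple j * (cs.simple i * cs.simple j) ^ n then 1 else 0) := by
  induction k with
  | zero => simp
  | succ k ih =>
    set a := cs.simple i
    set b := cs.simple j
    have haa : a * a = 1 := cs.simple_mul_simple_self i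
    have hbb : b * b = 1 := cs.simple_mul_simple_self j
    have hai : a⁻¹ = a := cs.inv_simple i
    have hbi : b⁻¹ = b := cs.inv_simple j
    -- Conjugation by `b` inverts `a * b`.
    have hconj : ∀ n : ℕ, ((a * b) ^ n)⁻¹ * b = b * (a * b) ^ n := by
      intro n
      have h1 : b * (a * b) ^ n * b⁻¹ = ((a * b) ^ n)⁻¹ := by
        rw [← conj_pow, ← inv_pow, mul_inv_rev, hai, hbi]
        congr 1
        simp only [mul_assoc, hbb, mul_one]
      rw [← h1]; simp [mul_assoc]
    have h1 : (a * b) ^ k * t * ((a * b) ^ k)⁻¹ = b ↔ t = b * (a * b) ^ (2 * k) := by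
      rw [mul_inv_eq_iff_eq_mul, ← eq_inv_mul_iff_mul_eq, ← mul_assoc, hconj, mul_assoc, ← pow_add,
        two_mul]
    have h2 : b * ((a * b) ^ k * t * ((a * b) ^ k)⁻¹) * b = a ↔
        t = b * (a * b) ^ (2 * k + 1) := by
      have e : ∀ x, b * x * b = a ↔ x = b * a * b := by
        intro x
        rw [← eq_mul_inv_iff_mul_eq, hbi]
        constructor
        · intro h
          rw [mul_assoc b a b, ← h, ← mul_assoc b b, hbb, one_mul]
        · rintro rfl
          rw [mul_assoc b a b, ← mul_assoc b b, hbb, one_mul]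
      rw [e, mul_inv_eq_iff_eq_mul, ← eq_inv_mul_iff_mul_eq, mul_assoc b a b, ← mul_assoc,
        ← mul_assoc, hconj, mul_assoc, mul_assoc, ← pow_succ', ← pow_add]
      congr! 3
      lia
    rw [pow_succ', Equiv.Perm.mul_apply, ih, Equiv.Perm.mul_apply, signedConj_apply,
      signedConj_apply, show 2 * (k + 1) = 2 * k + 1 + 1 by ring, Finset.sum_range_succ,
      Finset.sum_range_succ]
    rw [show cs.simple i = a from rfl, show cs.simple j = b from rfl]
    refine Prod.ext ?_ ?_
    · simp only [pow_succ', mul_inv_rev, hai, hbi, mul_assoc]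
    · simp only [h1, h2, add_assoc]

theorem isLiftable_signedConj : M.IsLiftable cs.signedConj := by
  classical
  intro i j
  ext1 ⟨t, ε⟩
  rw [signedConj_mul_pow_apply, cs.simple_mul_simple_pow, two_mul, Finset.sum_range_add]
  simp only [pow_add, cs.simple_mul_simple_pow, one_mul, CharTwo.add_self_eq_zero]
  simp

/-- The action of `W` on signed elements of `W`. -/
noncomputable def signedAction : W →* Equiv.Perm (W × ZMod 2) :=
  cs.lift ⟨cs.signedConj, cs.isLiftable_signedConj⟩

/-- The sign cocycle. For a reflection `t`, it is `1` exactly if `w` maps the positive root of `t`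
to a negative root, that is, if `t` is a right inversion of `w`. -/
noncomputable def inversionSign (w t : W) : ZMod 2 := (cs.signedAction w (t, 0)).2

open Classical in
theorem inversionSign_simple (i : B) (t : W) :
    cs.inversionSign (cs.simple i) t = if t = cs.simple i then 1 else 0 := by
  rw [inversionSign, signedAction, lift_apply_simple, signedConj_apply, zero_add]

theorem signedAction_apply (w t : W) (ε : ZMod 2) :
    cs.signedAction w (t, ε) = (w * t * w⁻¹, ε + cs.inversionSign w t) := by
  induction w using cs.simple_induction_left generalizing t ε with
  | one => simp [inversionSign]
  | mul_simple_left w i ih =>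
    have h : ∀ ε, cs.signedAction (cs.simple i * w) (t, ε) =
        cs.signedConj i (w * t * w⁻¹, ε + cs.inversionSign w t) := by
      intro ε
      rw [map_mul, Equiv.Perm.mul_apply, ih]
      simp [signedAction]
    rw [inversionSign, h, h, signedConj_apply, signedConj_apply]
    refine Prod.ext ?_ ?_
    · simp [mul_assoc]
    · simp [add_assoc]

@[simp] theorem inversionSign_one (t : W) : cs.inversionSign 1 t = 0 := by
  simp [inversionSign]

theorem inversionSign_mul (u v t : W) :
    cs.inversionSign (u * v) t = cs.inversionSign v t + cs.inversionSign u (v * t * v⁻¹) := by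
  have h := cs.signedAction_apply (u * v) t 0
  rw [map_mul, Equiv.Perm.mul_apply, signedAction_apply, signedAction_apply] at h
  simpa using (congrArg Prod.snd h).symm

theorem inversionSign_simple_self (i : B) :
    cs.inversionSign (cs.simple i) (cs.simple i) = 1 := by
  classical
  simp [inversionSign_simple]

theorem inversionSign_simple_of_ne {i : B} {t : W} (h : t ≠ cs.simple i) :
    cs.inversionSign (cs.simple i) t = 0 := by
  classical
  simp [inversionSign_simple, h]

theorem inversionSign_simple_mul (i : B) (w t : W) (h : w * t * w⁻¹ ≠ cs.simple i) :
    cs.inversionSign (cs.simple i * w) t = cs.inversionSign w t := by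
  rw [inversionSign_mul, cs.inversionSign_simple_of_ne h, add_zero]

/-- Conjugation respects signs up to those of the conjugating element, which cancel. -/
theorem inversionSign_conj (w g t : W) (h : g * t * g⁻¹ = t) :
    cs.inversionSign (w * g * w⁻¹) (w * t * w⁻¹) = cs.inversionSign g t := by
  have h0 := cs.inversionSign_mul w⁻¹ w t
  have e1 : w⁻¹ * (w * t * w⁻¹) * w⁻¹⁻¹ = t := by group
  rw [inv_mul_cancel, inversionSign_one] at h0
  rw [inversionSign_mul, e1, inversionSign_mul, h, add_left_comm,
    add_comm (cs.inversionSign w⁻¹ _), ← h0, add_zero]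

theorem IsReflection.inversionSign_self {t : W} (ht : cs.IsReflection t) :
    cs.inversionSign t t = 1 := by
  obtain ⟨w, i, rfl⟩ := ht
  rw [inversionSign_conj _ _ _ _ (by simp), inversionSign_simple_self]

theorem mem_rightInvSeq_of_inversionSign_ne_zero (ω : List B) {t : W}
    (h : cs.inversionSign (cs.wordProd ω) t ≠ 0) : t ∈ cs.rightInvSeq ω := by
  induction ω with
  | nil => simp at h
  | cons i ω ih =>
    rw [wordProd_cons] at h
    rw [rightInvSeq, List.mem_cons, or_iff_not_imp_left]
    intro hne
    rw [inversionSign_simple_mul] at h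
    · exact ih h
    · contrapose! hne
      rw [← hne]
      group

theorem finite_setOf_inversionSign_ne_zero (w : W) : {t | cs.inversionSign w t ≠ 0}.Finite := by
  obtain ⟨ω, rfl⟩ := cs.wordProd_surjective w
  exact (List.finite_toSet _).subset fun t => cs.mem_rightInvSeq_of_inversionSign_ne_zero ω

/-- The exchange condition. -/
theorem exists_eraseIdx_of_inversionSign_ne_zero (ω : List B) {t : W}
    (h : cs.inversionSign (cs.wordProd ω) t ≠ 0) :
    ∃ j < ω.length, cs.wordProd ω * t = cs.wordProd (ω.eraseIdx j) := by
  obtain ⟨j, hj, rfl⟩ := List.mem_iff_getElem.mp (cs.mem_rightInvSeq_of_inversionSign_ne_zero ω h)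
  rw [← List.getD_eq_getElem _ 1 hj, wordProd_mul_getD_rightInvSeq]
  exact ⟨j, by simpa using hj, rfl⟩

theorem length_mul_lt_of_inversionSign_ne_zero {w t : W} (h : cs.inversionSign w t ≠ 0) :
    cs.length (w * t) < cs.length w := by
  obtain ⟨ω, hω, rfl⟩ := cs.exists_isReduced w
  exact (cs.isRightInversion_of_mem_rightInvSeq hω
    (cs.mem_rightInvSeq_of_inversionSign_ne_zero ω h)).2

theorem IsReflection.inversionSign_mul_self {t : W} (ht : cs.IsReflection t) (w : W) :
    cs.inversionSign (w * t) t = cs.inversionSign w t + 1 := by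
  rw [inversionSign_mul, ht.inversionSign_self, mul_inv_cancel_right, add_comm]

theorem IsReflection.inversionSign_eq_zero_iff {t : W} (ht : cs.IsReflection t) (w : W) :
    cs.inversionSign w t = 0 ↔ cs.length w < cs.length (w * t) := by
  constructor
  · intro h
    have h1 := ht.inversionSign_mul_self cs w
    have h2 := cs.length_mul_lt_of_inversionSign_ne_zero (w := w * t) (t := t) (by simp [h1, h])
    rwa [mul_assoc, ht.mul_self, mul_one] at h2
  · intro h
    by_contra h0
    exact (cs.length_mul_lt_of_inversionSign_ne_zero h0).not_gt h

/-! ### Standard parabolic subgroups -/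

theorem simple_mem_standardParabolic {J : Set B} {i : B} (hi : i ∈ J) :
    cs.simple i ∈ cs.standardParabolic J :=
  Subgroup.subset_closure (Set.mem_image_of_mem _ hi)

theorem standardParabolic_mono {I J : Set B} (h : I ⊆ J) :
    cs.standardParabolic I ≤ cs.standardParabolic J :=
  Subgroup.closure_mono (Set.image_mono h)

theorem wordProd_mem_standardParabolic {J : Set B} {ω : List B} (h : ∀ i ∈ ω, i ∈ J) :
    cs.wordProd ω ∈ cs.standardParabolic J :=
  Subgroup.list_prod_mem _ fun x hx => by
    obtain ⟨i, hi, rfl⟩ := List.mem_map.mp hx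
    exact cs.simple_mem_standardParabolic (h i hi)

theorem exists_wordProd_of_mem_standardParabolic {J : Set B} {w : W}
    (hw : w ∈ cs.standardParabolic J) : ∃ ω : List B, (∀ i ∈ ω, i ∈ J) ∧ cs.wordProd ω = w := by
  induction hw using Subgroup.closure_induction with
  | mem x hx =>
    obtain ⟨i, hi, rfl⟩ := hx
    exact ⟨[i], by simpa using hi, by simp⟩
  | one => exact ⟨[], by simp, by simp⟩
  | mul x y _ _ hx hy =>
    obtain ⟨ω, hω, rfl⟩ := hx
    obtain ⟨ω', hω', rfl⟩ := hy
    exact ⟨ω ++ ω', by simpa [or_imp, forall_and] using ⟨hω, hω'⟩, cs.wordProd_append _ _⟩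
  | inv x _ hx =>
    obtain ⟨ω, hω, rfl⟩ := hx
    exact ⟨ω.reverse, by simpa using hω, by simp⟩

/-- The inversions of an element of a standard parabolic subgroup lie in that subgroup. -/
theorem mem_standardParabolic_of_inversionSign_ne_zero {J : Set B} {w t : W}
    (hw : w ∈ cs.standardParabolic J) (h : cs.inversionSign w t ≠ 0) :
    t ∈ cs.standardParabolic J := by
  obtain ⟨ω, hω, rfl⟩ := cs.exists_wordProd_of_mem_standardParabolic hw
  obtain ⟨j, -, hj⟩ := cs.exists_eraseIdx_of_inversionSign_ne_zero ω h
  rw [← Subgroup.mul_mem_cancel_left _ hw, hj]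
  exact cs.wordProd_mem_standardParabolic fun i hi => hω i (List.mem_of_mem_eraseIdx hi)

/-- An element of `W_J` without right descents in `J` is trivial. -/
theorem eq_one_of_mem_standardParabolic {J : Set B} {w : W} (hw : w ∈ cs.standardParabolic J)
    (h : ∀ j ∈ J, cs.inversionSign w (cs.simple j) = 0) : w = 1 := by
  obtain ⟨ω, hω, rfl⟩ := cs.exists_wordProd_of_mem_standardParabolic hw
  clear hw
  -- Two letters can be deleted from a nonempty word.
  induction hn : ω.length using Nat.strong_induction_on generalizing ω with
  | _ n ih =>
    rcases ω.eq_nil_or_concat' with rfl | ⟨ω', j, rfl⟩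
    · simp
    · have hj : j ∈ J := hω j (by simp)
      have h0 := h j hj
      have e : cs.wordProd (ω' ++ [j]) = cs.wordProd ω' * cs.simple j := by
        simp [wordProd_append]
      rw [e, (cs.isReflection_simple j).inversionSign_mul_self] at h0
      have h1 : cs.inversionSign (cs.wordProd ω') (cs.simple j) ≠ 0 := fun h => by simp [h] at h0
      obtain ⟨k, hk, hk'⟩ := cs.exists_eraseIdx_of_inversionSign_ne_zero ω' h1
      rw [e, hk'] at h ⊢
      have hlen := List.length_eraseIdx_of_lt hk
      simp only [List.length_append, List.length_singleton] at hn
      exact ih _ (by lia) _ (fun i hi => hω i (by simp [List.mem_of_mem_eraseIdx hi])) h rfl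

theorem simple_mem_standardParabolic_iff {J : Set B} {i : B} :
    cs.simple i ∈ cs.standardParabolic J ↔ i ∈ J := by
  refine ⟨fun h => ?_, cs.simple_mem_standardParabolic⟩
  by_contra hi
  refine cs.simple_ne_one i (cs.eq_one_of_mem_standardParabolic h fun j hj =>
    cs.inversionSign_simple_of_ne fun h => hi ?_)
  rwa [← cs.simple_injective h]

theorem exists_finite_mem_standardParabolic (w : W) :
    ∃ J : Set B, J.Finite ∧ w ∈ cs.standardParabolic J := by
  obtain ⟨ω, rfl⟩ := cs.wordProd_surjective w
  exact ⟨{i | i ∈ ω}, List.finite_toSet _, cs.wordProd_mem_standardParabolic fun _ => id⟩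

/-- An element without right descents in `J` has no inversions in `W_J`: it is the shortest element
of its coset modulo `W_J`. -/
theorem inversionSign_eq_zero_of_mem_standardParabolic {J : Set B} {w r : W}
    (h : ∀ j ∈ J, cs.inversionSign w (cs.simple j) = 0)
    (hrJ : r ∈ cs.standardParabolic J) : cs.inversionSign w r = 0 := by
  obtain ⟨y, ⟨d, hd, rfl⟩, hy⟩ := (measure cs.length).wf.has_min
    {y | ∃ d ∈ cs.standardParabolic J, y = w * d} ⟨w, 1, one_mem _, (mul_one w).symm⟩
  have hy' : ∀ r ∈ cs.standardParabolic J, cs.inversionSign (w * d) r = 0 := by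
    intro r hr
    by_contra h0
    exact hy (w * d * r) ⟨d * r, mul_mem hd hr, mul_assoc _ _ _⟩
      (cs.length_mul_lt_of_inversionSign_ne_zero h0)
  have hd1 : d⁻¹ = 1 := by
    refine cs.eq_one_of_mem_standardParabolic (inv_mem hd) fun j hj => ?_
    have h1 := cs.inversionSign_mul (w * d) d⁻¹ (cs.simple j)
    rw [mul_inv_cancel_right, h j hj, hy' _ (mul_mem (mul_mem (inv_mem hd)
      (cs.simple_mem_standardParabolic hj)) (inv_mem (inv_mem hd))), add_zero] at h1
    exact h1.symm
  have := hy' r hrJ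
  rwa [inv_eq_one.mp hd1, mul_one] at this

/-- If conjugation by a simple reflection outside `W_J` maps an element of `W_J` into `W_J`, then
it fixes this element. -/
theorem commute_simple_of_conj_mem_standardParabolic {J : Set B} {v : B} (hv : v ∉ J) {r : W}
    (hr : r ∈ cs.standardParabolic J)
    (h : cs.simple v * r * cs.simple v ∈ cs.standardParabolic J) : Commute r (cs.simple v) := by
  have hpos : ∀ x ∈ cs.standardParabolic J, cs.inversionSign x (cs.simple v) = 0 := by
    intro x hx
    by_contra h0
    exact hv (cs.simple_mem_standardParabolic_iff.mp
      (cs.mem_standardParabolic_of_inversionSign_ne_zero hx h0))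
  have h1 := (cs.isReflection_simple v).inversionSign_mul_self cs (cs.simple v * r * cs.simple v)
  rw [simple_mul_simple_cancel_right, hpos _ h, zero_add] at h1
  by_contra hne
  rw [cs.inversionSign_simple_mul, hpos _ hr] at h1
  · exact zero_ne_one h1
  · rw [Ne, mul_inv_eq_iff_eq_mul]
    exact hne

end CoxeterSystem

/-! ### Conjugacy classes and the Coxeter graph -/

theorem isAlmostCentral_iff_finite_range {G : Type*} [Group G] (g : G) :
    IsAlmostCentral g ↔ (Set.range fun w : G => w * g * w⁻¹).Finite := by
  have horbit : (Set.range fun w : G => w * g * w⁻¹) = MulAction.orbit (ConjAct G) g := by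
    ext x
    rw [ConjAct.mem_orbit_conjAct, isConj_comm, isConj_iff]
    rfl
  have hindex : (Subgroup.centralizer {g}).index = (MulAction.stabilizer (ConjAct G) g).index := by
    rw [ConjAct.stabilizer_eq_centralizer]
    rfl
  rw [IsAlmostCentral, Subgroup.finiteIndex_iff, hindex, MulAction.index_stabilizer, horbit]
  refine ⟨Set.finite_of_ncard_ne_zero, fun h => ?_⟩
  rw [Ne, Set.ncard_eq_zero h]
  exact (MulAction.nonempty_orbit g).ne_empty

theorem Set.Finite.range_of_factorsThrough {α β γ : Type*} {f : α → β} {g : α → γ}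
    (hf : (Set.range f).Finite) (h : g.FactorsThrough f) : (Set.range g).Finite := by
  rcases isEmpty_or_nonempty α with _ | ⟨⟨a⟩⟩
  · exact Set.finite_range g
  · have : g = Function.extend f g (fun _ => g a) ∘ f := (h.extend_comp _).symm
    rw [this, Set.range_comp]
    exact hf.image _

theorem IsAlmostCentral.conj {G : Type*} [Group G] {g : G} (h : IsAlmostCentral g) (w : G) :
    IsAlmostCentral (w * g * w⁻¹) := by
  rw [isAlmostCentral_iff_finite_range] at h ⊢
  refine h.subset ?_
  rintro _ ⟨u, rfl⟩
  exact ⟨u * w, by group⟩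

theorem IsAlmostCentral.mul {G : Type*} [Group G] {g h : G} (hg : IsAlmostCentral g)
    (hh : IsAlmostCentral h) : IsAlmostCentral (g * h) := by
  rw [isAlmostCentral_iff_finite_range] at hg hh ⊢
  refine (hg.mul hh).subset ?_
  rintro _ ⟨u, rfl⟩
  exact Set.mem_mul.mpr ⟨_, ⟨u, rfl⟩, _, ⟨u, rfl⟩, by group⟩

namespace CoxeterSystem

variable {B W : Type*} [Group W] {M : CoxeterMatrix B} (cs : CoxeterSystem M W)

/-- Let `s` and `t` be simple reflections that do not commute. An element fixing the roots of `s`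
and of `t * s * t` commutes with `t`. In the reflection representation this is clear, because the
two roots span the same plane as those of `s` and `t`. Here the reason is that an element without
the inversions `s` and `t` does not have the inversion `t * s * t` either. -/
theorem conj_simple_eq_of_conj_eq {i j : B} (hij : ¬ Commute (cs.simple i) (cs.simple j)) {n : W}
    (h1 : n * cs.simple i * n⁻¹ = cs.simple i) (h1' : cs.inversionSign n (cs.simple i) = 0)
    (h2 : n * (cs.simple j * cs.simple i * cs.simple j) * n⁻¹ =
      cs.simple j * cs.simple i * cs.simple j)
    (h2' : cs.inversionSign n (cs.simple j * cs.simple i * cs.simple j) = 0) :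
    n * cs.simple j * n⁻¹ = cs.simple j := by
  -- The inversions of an element in the dihedral subgroup of `s` and `t` are convex.
  have hconv : ∀ x, cs.inversionSign x (cs.simple i) = 0 → cs.inversionSign x (cs.simple j) = 0 →
      cs.inversionSign x (cs.simple j * cs.simple i * cs.simple j) = 0 := by
    intro x hx hx'
    refine cs.inversionSign_eq_zero_of_mem_standardParabolic (J := {i, j}) ?_ ?_
    · rintro k (rfl | rfl) <;> assumption
    · exact mul_mem (mul_mem (cs.simple_mem_standardParabolic (by simp))
        (cs.simple_mem_standardParabolic (by simp))) (cs.simple_mem_standardParabolic (by simp))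
  set s := cs.simple i with hs
  set t := cs.simple j with ht
  set r := t * s * t with hr
  have htt : t * t = 1 := cs.simple_mul_simple_self j
  have hti : t⁻¹ = t := cs.inv_simple j
  have hst : s ≠ t := fun h => hij (h ▸ Commute.refl _)
  have hrs : r ≠ s := fun h => hij <| by
    have h3 : t * s * t * t = s * t := congrArg (· * t) h
    rw [mul_assoc, htt, mul_one] at h3
    exact h3.symm
  have hrt : r ≠ t := fun h => hst <| by
    rw [hr, mul_assoc, mul_eq_left] at h
    rw [eq_inv_of_mul_eq_one_left h, hti]
  have htr : t * r * t⁻¹ = s := by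
    rw [hr, hti, mul_assoc, mul_assoc, mul_assoc, htt, mul_one, ← mul_assoc, htt, one_mul]
  have hts : t * s * t⁻¹ = r := by rw [hti]
  have hinj : ∀ x y, n * x * n⁻¹ = n * y * n⁻¹ → x = y := fun x y h => by simpa using h
  have hss : cs.inversionSign s s = 1 := cs.inversionSign_simple_self i
  by_cases h0 : cs.inversionSign n t = 0
  · by_contra hne
    have e : ∀ x, t * n * x * (t * n)⁻¹ = t * (n * x * n⁻¹) * t⁻¹ := fun x => by group
    have a1 : cs.inversionSign (t * n) s = 0 := by
      rw [inversionSign_simple_mul _ _ _ _ (by rw [h1]; exact hst), h1']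
    have a2 : cs.inversionSign (t * n) t = 0 := by
      rw [inversionSign_simple_mul _ _ _ _ hne, h0]
    have a3 : cs.inversionSign (t * n) r = 0 := by
      rw [inversionSign_simple_mul _ _ _ _ (by rw [h2]; exact hrt), h2']
    have b1 : cs.inversionSign (s * (t * n)) s = 0 := by
      rw [inversionSign_simple_mul _ _ _ _ (by rw [e, h1, hts]; exact hrs), a1]
    have b2 : cs.inversionSign (s * (t * n)) t = 0 := by
      rw [inversionSign_simple_mul, a2]
      rw [e, ← hs, ← htr]
      intro h
      have h3 : n * t * n⁻¹ = r := by simpa using h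
      rw [← h2] at h3
      exact hrt (hinj _ _ h3).symm
    have b3 := hconv _ b1 b2
    rw [inversionSign_mul, a3, zero_add, e, h2, htr, hss] at b3
    exact one_ne_zero b3
  · exfalso
    have h0' : cs.inversionSign n t = 1 := Fin.eq_one_of_ne_zero _ h0
    have e : ∀ x, n * t * x * (n * t)⁻¹ = n * (t * x * t⁻¹) * n⁻¹ := fun x => by group
    have a1 : cs.inversionSign (n * t) s = 0 := by
      rw [inversionSign_mul, cs.inversionSign_simple_of_ne hst, hts, h2', add_zero]
    have a2 : cs.inversionSign (n * t) t = 0 := by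
      rw [(cs.isReflection_simple j).inversionSign_mul_self, h0']
      rfl
    have a3 : cs.inversionSign (n * t) r = 0 := by
      rw [inversionSign_mul, cs.inversionSign_simple_of_ne hrt, htr, h1', add_zero]
    have b1 : cs.inversionSign (s * (n * t)) s = 0 := by
      rw [inversionSign_simple_mul _ _ _ _ (by rw [e, hts, h2]; exact hrs), a1]
    have b2 : cs.inversionSign (s * (n * t)) t = 0 := by
      rw [inversionSign_simple_mul, a2]
      rw [e, mul_inv_cancel_right, ← hs]
      intro h
      rw [← h1] at h
      exact hst (hinj _ _ h).symm
    have b3 := hconv _ b1 b2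
    rw [inversionSign_mul, a3, zero_add, e, htr, h1, hss] at b3
    exact one_ne_zero b3

/-- If two elements move the positive root of `t` to the same root, then their quotient fixes this
root. -/
theorem conj_eq_and_inversionSign_eq_zero_of_signedAction_eq {w w' t : W}
    (h : cs.signedAction w (t, 0) = cs.signedAction w' (t, 0)) :
    (w'⁻¹ * w) * t * (w'⁻¹ * w)⁻¹ = t ∧ cs.inversionSign (w'⁻¹ * w) t = 0 := by
  have h1 : cs.signedAction (w'⁻¹ * w) (t, 0) = (t, 0) := by
    rw [map_mul, Equiv.Perm.mul_apply, h, ← Equiv.Perm.mul_apply, ← map_mul]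
    simp
  rw [signedAction_apply, Prod.mk.injEq, zero_add] at h1
  exact h1

theorem finite_range_signedAction {t : W} (ht : IsAlmostCentral t) :
    (Set.range fun w => cs.signedAction w (t, 0)).Finite := by
  rw [isAlmostCentral_iff_finite_range] at ht
  refine (ht.prod (Set.finite_univ (α := ZMod 2))).subset ?_
  rintro _ ⟨w, rfl⟩
  exact ⟨⟨w, by simp [signedAction_apply]⟩, Set.mem_univ _⟩

theorem isAlmostCentral_simple_of_not_commute {i j : B}
    (hij : ¬ Commute (cs.simple i) (cs.simple j)) (hi : IsAlmostCentral (cs.simple i)) :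
    IsAlmostCentral (cs.simple j) := by
  have hj : IsAlmostCentral (cs.simple j * cs.simple i * cs.simple j) := by
    simpa using hi.conj (cs.simple j)
  have hfin := (cs.finite_range_signedAction hi).prod (cs.finite_range_signedAction hj)
  rw [isAlmostCentral_iff_finite_range]
  refine Set.Finite.range_of_factorsThrough (f := fun w => (cs.signedAction w (cs.simple i, 0),
    cs.signedAction w (cs.simple j * cs.simple i * cs.simple j, 0)))
    (hfin.subset ?_) fun w w' h => ?_
  · rintro _ ⟨w, rfl⟩
    exact ⟨⟨w, rfl⟩, w, rfl⟩
  · rw [Prod.mk.injEq] at h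
    obtain ⟨a1, a2⟩ := cs.conj_eq_and_inversionSign_eq_zero_of_signedAction_eq h.1
    obtain ⟨b1, b2⟩ := cs.conj_eq_and_inversionSign_eq_zero_of_signedAction_eq h.2
    have h3 := cs.conj_simple_eq_of_conj_eq hij a1 a2 b1 b2
    calc w * cs.simple j * w⁻¹
        = w' * ((w'⁻¹ * w) * cs.simple j * (w'⁻¹ * w)⁻¹) * w'⁻¹ := by group
      _ = w' * cs.simple j * w'⁻¹ := by rw [h3]

theorem isAlmostCentral_simple_of_reachable {i j : B} (hij : M.coxeterGraph.Reachable i j)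
    (hi : IsAlmostCentral (cs.simple i)) : IsAlmostCentral (cs.simple j) := by
  rw [SimpleGraph.reachable_iff_reflTransGen] at hij
  induction hij with
  | refl => exact hi
  | tail _ hadj ih =>
    exact cs.isAlmostCentral_simple_of_not_commute (cs.not_commute_simple_of_adj hadj) ih

/-- The vertices of the Coxeter graph at distance at most `k` from `i`. -/
def _root_.CoxeterMatrix.coxeterBall (M : CoxeterMatrix B) (i : B) : ℕ → Set B
  | 0 => {i}
  | k + 1 => M.coxeterBall i k ∪ {v | ∃ u ∈ M.coxeterBall i k, M.coxeterGraph.Adj u v}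

theorem _root_.CoxeterMatrix.exists_mem_coxeterBall {i j : B}
    (hij : M.coxeterGraph.Reachable i j) : ∃ k, j ∈ M.coxeterBall i k := by
  rw [SimpleGraph.reachable_iff_reflTransGen] at hij
  induction hij with
  | refl => exact ⟨0, rfl⟩
  | tail _ hadj ih =>
    obtain ⟨k, hk⟩ := ih
    exact ⟨k + 1, Or.inr ⟨_, hk, hadj⟩⟩

/-- Conjugating `s i` successively along a geodesic from `i` to `v` without its endpoint `v` gives
an element that does not commute with `s v`. -/
theorem exists_conj_not_commute_of_mem_coxeterBall (i : B) (k : ℕ) {v : B}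
    (hv : v ∈ M.coxeterBall i (k + 1)) (hv' : v ∉ M.coxeterBall i k) :
    ∃ w, w * cs.simple i * w⁻¹ ∈ cs.standardParabolic (M.coxeterBall i k) ∧
      ¬ Commute (w * cs.simple i * w⁻¹) (cs.simple v) := by
  induction k generalizing v with
  | zero =>
    obtain ⟨u, hu, huv⟩ := hv.resolve_left hv'
    obtain rfl : u = i := hu
    refine ⟨1, ?_, ?_⟩
    · simpa using cs.simple_mem_standardParabolic (J := M.coxeterBall u 0) (Set.mem_singleton u)
    · simpa using cs.not_commute_simple_of_adj huv
  | succ k ih =>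
    obtain ⟨u, hu, huv⟩ := hv.resolve_left hv'
    have hu' : u ∉ M.coxeterBall i k := fun h => hv' (Or.inr ⟨u, h, huv⟩)
    obtain ⟨w, hw, hwu⟩ := ih hu hu'
    have hle : cs.standardParabolic (M.coxeterBall i k) ≤
        cs.standardParabolic (M.coxeterBall i (k + 1)) :=
      cs.standardParabolic_mono Set.subset_union_left
    set y := w * cs.simple i * w⁻¹ with hy
    have hsu := cs.simple_mem_standardParabolic hu
    have e : cs.simple u * w * cs.simple i * (cs.simple u * w)⁻¹ =
        cs.simple u * y * cs.simple u := by
      rw [hy, mul_inv_rev, inv_simple]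
      simp only [mul_assoc]
    refine ⟨cs.simple u * w, ?_, ?_⟩
    · rw [e]
      exact mul_mem (mul_mem hsu (hle hw)) hsu
    rw [e]
    intro hc
    -- Now `y` commutes with `s v`, as `v` is not adjacent to any vertex within distance `k` of `i`.
    have hyv : Commute y (cs.simple v) := by
      have hsub : cs.standardParabolic (M.coxeterBall i k) ≤
          Subgroup.centralizer {cs.simple v} := by
        rw [standardParabolic, Subgroup.closure_le]
        rintro _ ⟨x, hx, rfl⟩
        rw [SetLike.mem_coe, Subgroup.mem_centralizer_singleton_iff]
        exact cs.commute_simple_of_not_adj fun h => hv' (Or.inr ⟨x, hx, h⟩)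
      exact Subgroup.mem_centralizer_singleton_iff.mp (hsub hw)
    have hyuv : Commute y (cs.simple u * cs.simple v * cs.simple u) := by
      have h3 := hc.eq
      rw [Commute, SemiconjBy]
      calc y * (cs.simple u * cs.simple v * cs.simple u)
          = cs.simple u * (cs.simple u * y * cs.simple u * cs.simple v) * cs.simple u := by
            simp [mul_assoc]
        _ = cs.simple u * cs.simple v * cs.simple u * y := by
            rw [h3]
            simp [mul_assoc]
    refine hwu (mul_inv_eq_iff_eq_mul.mp (cs.conj_simple_eq_of_conj_eq
      (cs.not_commute_simple_of_adj huv.symm) (mul_inv_eq_iff_eq_mul.mpr hyv.eq) ?_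
      (mul_inv_eq_iff_eq_mul.mpr hyuv.eq) ?_))
    · by_contra h0
      exact hv' (cs.simple_mem_standardParabolic_iff.mp
        (hle (cs.mem_standardParabolic_of_inversionSign_ne_zero hw h0)))
    · by_contra h0
      have h1 := hle (cs.mem_standardParabolic_of_inversionSign_ne_zero hw h0)
      rw [Subgroup.mul_mem_cancel_right _ hsu, Subgroup.mul_mem_cancel_left _ hsu] at h1
      exact hv' (cs.simple_mem_standardParabolic_iff.mp h1)

/-- The conjugates of an almost central simple reflection lie in a standard parabolic subgroup of
finite rank, which has to contain all vertices of its component. -/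
theorem finite_supp_of_isAlmostCentral {i : B} (hi : IsAlmostCentral (cs.simple i)) :
    (M.coxeterGraph.connectedComponentMk i).supp.Finite := by
  rw [isAlmostCentral_iff_finite_range] at hi
  choose K hK hmem using cs.exists_finite_mem_standardParabolic
  set J := ⋃ x ∈ Set.range fun w => w * cs.simple i * w⁻¹, K x with hJ
  have hJfin : J.Finite := hi.biUnion fun x _ => hK x
  have hle : ∀ w, w * cs.simple i * w⁻¹ ∈ cs.standardParabolic J := fun w =>
    cs.standardParabolic_mono (Set.subset_biUnion_of_mem (u := K) (Set.mem_range_self w)) (hmem _)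
  refine (hJfin.insert i).subset fun v hv => ?_
  rw [Set.mem_insert_iff, or_iff_not_imp_left]
  intro hvi
  by_contra hvJ
  have hreach : M.coxeterGraph.Reachable i v := (SimpleGraph.ConnectedComponent.exact hv).symm
  classical
  have hex := M.exists_mem_coxeterBall hreach
  obtain ⟨k, hk⟩ : ∃ k, Nat.find hex = k + 1 := Nat.exists_eq_succ_of_ne_zero fun h0 => hvi <| by
    have := Nat.find_spec hex
    rwa [h0] at this
  have h1 : v ∈ M.coxeterBall i (k + 1) := hk ▸ Nat.find_spec hex
  have h2 : v ∉ M.coxeterBall i k := Nat.find_min hex (by lia)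
  obtain ⟨w, -, hw⟩ := cs.exists_conj_not_commute_of_mem_coxeterBall i k h1 h2
  refine hw (cs.commute_simple_of_conj_mem_standardParabolic hvJ (hle w) ?_)
  convert hle (cs.simple v * w) using 1
  simp [mul_assoc]

/-- An element of `W_J` is determined by the images of the positive roots of the simple reflections
in `J`. -/
theorem finite_standardParabolic {J : Set B} (hJ : J.Finite)
    (h : ∀ j ∈ J, IsAlmostCentral (cs.simple j)) : Finite (cs.standardParabolic J) := by
  have : Finite J := hJ
  have hT : (⋃ j ∈ J, Set.range fun w => cs.signedAction w (cs.simple j, 0)).Finite :=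
    hJ.biUnion fun j hj => cs.finite_range_signedAction (h j hj)
  set T := ⋃ j ∈ J, Set.range fun w => cs.signedAction w (cs.simple j, 0)
  have : Finite T := hT
  refine Finite.of_injective (β := J → T) (fun w j => ⟨cs.signedAction w.1 (cs.simple j, 0),
    Set.mem_biUnion j.2 ⟨w.1, rfl⟩⟩) fun w w' hww' => ?_
  have h1 : w'.1⁻¹ * w.1 = 1 := by
    refine cs.eq_one_of_mem_standardParabolic (mul_mem (inv_mem w'.2) w.2) fun j hj => ?_
    exact (cs.conj_eq_and_inversionSign_eq_zero_of_signedAction_eq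
      (congrArg Subtype.val (congrFun hww' ⟨j, hj⟩))).2
  exact Subtype.ext (inv_mul_eq_one.mp h1).symm

theorem finite_irreducibleComponent_of_isAlmostCentral {i : B}
    (hi : IsAlmostCentral (cs.simple i)) :
    Finite (cs.irreducibleComponent (M.coxeterGraph.connectedComponentMk i)) :=
  cs.finite_standardParabolic (cs.finite_supp_of_isAlmostCentral hi) fun _ hj =>
    cs.isAlmostCentral_simple_of_reachable (SimpleGraph.ConnectedComponent.exact hj).symm hi

/-! ### The finite part -/

instance normal_irreducibleComponent (c : M.coxeterGraph.ConnectedComponent) :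
    (cs.irreducibleComponent c).Normal := by
  have key : ∀ i : B, ∀ x ∈ cs.irreducibleComponent c,
      cs.simple i * x * cs.simple i ∈ cs.irreducibleComponent c := by
    intro i x hx
    by_cases hi : i ∈ c.supp
    · have hi' : cs.simple i ∈ cs.irreducibleComponent c := cs.simple_mem_standardParabolic hi
      exact mul_mem (mul_mem hi' hx) hi'
    · have hsub : cs.irreducibleComponent c ≤ Subgroup.centralizer {cs.simple i} := by
        rw [irreducibleComponent, standardParabolic, Subgroup.closure_le]
        rintro _ ⟨j, hj, rfl⟩
        rw [SetLike.mem_coe, Subgroup.mem_centralizer_singleton_iff]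
        exact cs.commute_simple_of_not_adj fun h => hi (c.mem_supp_of_adj_mem_supp hj h)
      rw [← Subgroup.mem_centralizer_singleton_iff.mp (hsub hx), simple_mul_simple_cancel_right]
      exact hx
  refine ⟨fun x hx w => ?_⟩
  induction w using cs.simple_induction_left with
  | one => simpa using hx
  | mul_simple_left w i ih =>
    convert key i _ ih using 1
    simp [mul_assoc]

instance normal_finitePart : cs.finitePart.Normal := by
  refine ⟨fun x hx w => ?_⟩
  rw [finitePart] at hx ⊢
  have h : (⨆ (c : M.coxeterGraph.ConnectedComponent) (_ : Finite (cs.irreducibleComponent c)),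
      cs.irreducibleComponent c) ≤ (⨆ (c : M.coxeterGraph.ConnectedComponent)
      (_ : Finite (cs.irreducibleComponent c)), cs.irreducibleComponent c).comap
        (MulAut.conj w).toMonoidHom :=
    iSup₂_le fun c hc y hy => (le_iSup₂ (f := fun c (_ : Finite (cs.irreducibleComponent c)) =>
      cs.irreducibleComponent c) c hc) ((cs.normal_irreducibleComponent c).conj_mem y hy w)
  exact h hx

theorem simple_mem_finitePart {i : B} (hi : IsAlmostCentral (cs.simple i)) :
    cs.simple i ∈ cs.finitePart :=
  le_iSup₂ (f := fun c (_ : Finite (cs.irreducibleComponent c)) => cs.irreducibleComponent c) _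
    (cs.finite_irreducibleComponent_of_isAlmostCentral hi)
    (cs.simple_mem_standardParabolic SimpleGraph.ConnectedComponent.connectedComponentMk_mem)

/-- If `g` maps the root of `t` to its negative, then each conjugate of `t` is an inversion of the
corresponding conjugate of `g`; there are finitely many of these if `g` is almost central. -/
theorem isAlmostCentral_of_inversionSign_ne_zero {g t : W} (hg : IsAlmostCentral g)
    (h : g * t * g⁻¹ = t) (h' : cs.inversionSign g t ≠ 0) : IsAlmostCentral t := by
  rw [isAlmostCentral_iff_finite_range] at hg ⊢
  refine (hg.biUnion fun x _ => cs.finite_setOf_inversionSign_ne_zero x).subset ?_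
  rintro _ ⟨w, rfl⟩
  refine Set.mem_biUnion ⟨w, rfl⟩ ?_
  rw [Set.mem_ofPred_eq, cs.inversionSign_conj w g t h]
  exact h'

/-- If a simple reflection is a left and a right descent of `g`, then conjugation by it either
fixes `g` or makes it shorter. -/
theorem conj_eq_or_length_conj_lt {g : W} {i : B} (hl : cs.length (cs.simple i * g) < cs.length g)
    (hr : cs.length (g * cs.simple i) < cs.length g) :
    g * cs.simple i * g⁻¹ = cs.simple i ∨
      cs.length (cs.simple i * g * cs.simple i) < cs.length g := by
  rw [or_iff_not_imp_left]
  intro hne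
  have hs := cs.isReflection_simple i
  have h1 : cs.inversionSign g (cs.simple i) ≠ 0 := by
    rw [Ne, hs.inversionSign_eq_zero_iff]
    exact hr.not_gt
  rw [← cs.inversionSign_simple_mul i g _ hne] at h1
  exact (cs.length_mul_lt_of_inversionSign_ne_zero h1).trans hl

/-- An almost central element of order at most two lies in the finite part, by induction on its
length: either a descent commutes with it, and then is itself almost central, or conjugation by
the descent makes it shorter. -/
theorem mem_finitePart_of_isAlmostCentral {g : W} (hg : IsAlmostCentral g) (hgg : g * g = 1) :
    g ∈ cs.finitePart := by
  induction hn : cs.length g using Nat.strong_induction_on generalizing g with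
  | _ n ih =>
    rcases eq_or_ne g 1 with rfl | hg1
    · exact one_mem _
    obtain ⟨i, hi⟩ := cs.exists_rightDescent_of_ne_one hg1
    have hginv : g⁻¹ = g := inv_eq_of_mul_eq_one_left hgg
    have hi' : cs.IsLeftDescent g i := by
      rw [← isRightDescent_inv_iff, hginv]
      exact hi
    by_cases hc : g * cs.simple i * g⁻¹ = cs.simple i
    · have hs : IsAlmostCentral (cs.simple i) := by
        refine cs.isAlmostCentral_of_inversionSign_ne_zero hg hc ?_
        rw [Ne, (cs.isReflection_simple i).inversionSign_eq_zero_iff]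
        exact hi.not_gt
      rw [← Subgroup.mul_mem_cancel_right _ (cs.simple_mem_finitePart hs)]
      refine ih _ (hn ▸ hi) (hg.mul hs) ?_ rfl
      rw [← mul_assoc, mul_assoc g, ← mul_inv_eq_iff_eq_mul.mp hc, ← mul_assoc, hgg, one_mul,
        simple_mul_simple_self]
    · have hlen := (cs.conj_eq_or_length_conj_lt hi' hi).resolve_left hc
      have hmem : cs.simple i * g * cs.simple i ∈ cs.finitePart := by
        refine ih _ (hn ▸ hlen) (by simpa using hg.conj (cs.simple i)) ?_ rfl
        calc cs.simple i * g * cs.simple i * (cs.simple i * g * cs.simple i)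
            = cs.simple i * (g * g) * cs.simple i := by simp [mul_assoc]
          _ = 1 := by simp [hgg]
      have := cs.normal_finitePart.conj_mem _ hmem (cs.simple i)
      simpa [mul_assoc] using this

/-- A simple reflection of a finite component has all its conjugates in this component, as
components are normal. -/
theorem isAlmostCentral_simple_of_finite {i : B} {c : M.coxeterGraph.ConnectedComponent}
    (hi : i ∈ c.supp) (hc : Finite (cs.irreducibleComponent c)) :
    IsAlmostCentral (cs.simple i) := by
  rw [isAlmostCentral_iff_finite_range]
  refine (Set.toFinite (cs.irreducibleComponent c : Set W)).subset ?_
  rintro _ ⟨w, rfl⟩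
  exact (cs.normal_irreducibleComponent c).conj_mem _ (cs.simple_mem_standardParabolic hi) w

theorem closure_almostCentralInvolutions :
    Subgroup.closure (almostCentralInvolutions W) = cs.finitePart := by
  apply le_antisymm
  · rw [Subgroup.closure_le]
    rintro g ⟨hg, hg'⟩
    refine cs.mem_finitePart_of_isAlmostCentral hg' ?_
    rw [← pow_two, ← hg, pow_orderOf_eq_one]
  · refine iSup₂_le fun c hc => ?_
    rw [irreducibleComponent, standardParabolic]
    refine Subgroup.closure_mono ?_
    rintro _ ⟨i, hi, rfl⟩
    exact ⟨orderOf_eq_prime (cs.simple_sq i) (cs.simple_ne_one i),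
      cs.isAlmostCentral_simple_of_finite hi hc⟩

theorem finitePart_eq_bot (hM : M.coxeterGraph.Connected) [Infinite W] : cs.finitePart = ⊥ := by
  refine iSup₂_eq_bot.mpr fun c hc => absurd hc ?_
  have hsupp : c.supp = Set.univ := by
    obtain ⟨i, hi⟩ := c.nonempty_supp
    refine Set.eq_univ_of_forall fun j => ?_
    rw [SimpleGraph.ConnectedComponent.mem_supp_iff] at hi ⊢
    rw [← hi]
    exact SimpleGraph.ConnectedComponent.sound (hM.preconnected j i)
  rw [irreducibleComponent, standardParabolic, hsupp, Set.image_univ,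
    subgroup_closure_range_simple]
  intro h
  have : Finite W := Subgroup.topEquiv.toEquiv.finite_iff.mp h
  exact not_finite W

end CoxeterSystem

theorem IsAlmostCentral.map_mulEquiv {G H : Type*} [Group G] [Group H] (f : G ≃* H) {g : G}
    (hg : IsAlmostCentral g) : IsAlmostCentral (f g) := by
  rw [isAlmostCentral_iff_finite_range] at hg ⊢
  refine (hg.image f).subset ?_
  rintro _ ⟨w, rfl⟩
  exact ⟨_, ⟨f.symm w, rfl⟩, by simp⟩

theorem image_almostCentralInvolutions {G H : Type*} [Group G] [Group H] (f : G ≃* H) :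
    f '' almostCentralInvolutions G = almostCentralInvolutions H := by
  ext x
  constructor
  · rintro ⟨g, ⟨hg, hg'⟩, rfl⟩
    exact ⟨by rw [f.orderOf_eq, hg], hg'.map_mulEquiv f⟩
  · rintro ⟨hx, hx'⟩
    exact ⟨f.symm x, ⟨by rw [f.symm.orderOf_eq, hx], hx'.map_mulEquiv f.symm⟩, by simp⟩

theorem mainTheorem7 {B W : Type*} [Group W] {M : CoxeterMatrix B} (cs : CoxeterSystem M W) :
    -- the almost central involutions generate the finite part
    Subgroup.closure (almostCentralInvolutions W) = cs.finitePart ∧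
    -- the finite part does not depend on the Coxeter generating set
    (∀ {B' : Type*} {M' : CoxeterMatrix B'} (cs' : CoxeterSystem M' W),
      cs'.finitePart = cs.finitePart) ∧
    -- isomorphisms of Coxeter groups, as abstract groups, preserve the finite part
    (∀ {B' W' : Type*} [Group W'] {M' : CoxeterMatrix B'} (cs' : CoxeterSystem M' W')
      (f : W ≃* W'), cs.finitePart.map f.toMonoidHom = cs'.finitePart) ∧
    -- an infinite irreducible Coxeter group has no almost central involution
    (M.coxeterGraph.Connected → Infinite W → almostCentralInvolutions W = ∅) := by
  refine ⟨cs.closure_almostCentralInvolutions, fun cs' => ?_, fun cs' f => ?_, fun hM hW => ?_⟩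
  · rw [← cs.closure_almostCentralInvolutions, ← cs'.closure_almostCentralInvolutions]
  · rw [← cs.closure_almostCentralInvolutions, ← cs'.closure_almostCentralInvolutions,
      MonoidHom.map_closure, ← image_almostCentralInvolutions f]
    rfl
  · refine Set.eq_empty_of_forall_notMem fun g hg => ?_
    have h1 : g ∈ cs.finitePart := by
      rw [← cs.closure_almostCentralInvolutions]
      exact Subgroup.subset_closure hg
    rw [cs.finitePart_eq_bot hM, Subgroup.mem_bot] at h1
    have h2 := hg.1
    rw [h1, orderOf_one] at h2
    exact absurd h2 (by norm_num)
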